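/- Let $N\ge 2$ and $\rho_L,\rho_R\in(0,1)$. Consider the boundary driven symmetric simple exclusion process on the homogeneous segment $[N-1]=\{1,\dots,N-1\}$, i.e. the continuous-time Markov process $(\eta_t)_{t\ge0}$ on $\{0,1\}^{[N-1]}$ in which particles jump, subject to exclusion, from a site to each empty nearest-neighbour site at rate $1$, a particle is created at site $1$ at rate $\rho_L$ if it is empty and destroyed at rate $1-\rho_L$ if it is occupied, and a particle is created at site $N-1$ at rate $\rho_R$ if it is empty and destroyed at rate $1-\rho_R$ if it is occupied. This process has a unique stationary distribution $\mu$, and for all $n$ and $1\le x_1<\dots<x_n\le N-1$, $$\mathbb E_{\mu}\Big[\prod_{i=1}^n\big(\eta(x_i)-\mathbb E_{\mu}[\eta(x_i)]\big)\Big]=(\rho_R-\rho_L)^n\,\psi(x_1,\dots,x_n),$$ where $$\psi(x_1,\dots,x_n)=\sum_{j=0}^n(-1)^{n-j}\sum_{1\le i_1<\dots<i_j\le n}\ \prod_{\ell=1}^{j}\frac{x_{i_\ell}-(\ell-1)}{N-(\ell-1)}\prod_{r\in\{1,\dots,n\}\setminus\{i_1,\dots,i_j\}}\frac{x_r}{N},$$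 and $$\mathbb E_{\mu}\Big[\prod_{i=1}^n\eta(x_i)\Big]=\sum_{j=0}^n\rho_L^{\,n-j}(\rho_R-\rho_L)^j\sum_{1\le i_1<\dots<i_j\le n}\ \prod_{\ell=1}^{j}\frac{x_{i_\ell}-(\ell-1)}{N-(\ell-1)}.$$ -/

import Mathlib

open MeasureTheory

noncomputable section

namespace OpenSEP

/-- The bulk vertices `[N-1] = {1, …, N-1}`. -/
abbrev Site (N : ℕ) : Type := {x : ℕ // x ∈ Finset.Icc 1 (N - 1)}

/-- Particle configurations `{0,1}^{[N-1]}` (`true`: occupied, `false`: empty). -/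
abbrev Config (N : ℕ) : Type := Site N → Bool

/-- The occupation variable `η(x)`, as a real number in `{0,1}`. -/
def occ {N : ℕ} (η : Config N) (x : Site N) : ℝ := if η x = true then 1 else 0

/-- The vertex `1`, attached to the left reservoir. -/
def leftSite {N : ℕ} (hN : 2 ≤ N) : Site N := ⟨1, Finset.mem_Icc.2 ⟨le_refl 1, by omega⟩⟩

/-- The vertex `N-1`, attached to the right reservoir. -/
def rightSite {N : ℕ} (hN : 2 ≤ N) : Site N :=
  ⟨N - 1, Finset.mem_Icc.2 ⟨by omega, le_refl _⟩⟩

/-- `η^{x,y}`: the particle at `x` (if any) is removed from `x` and put at `y`. -/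
def move {N : ℕ} (η : Config N) (x y : Site N) : Config N :=
  if η x = true then Function.update (Function.update η x false) y true else η

/-- `η^{x,-}`: the particle at `x` (if any) is destroyed. -/
def destroy {N : ℕ} (η : Config N) (x : Site N) : Config N := Function.update η x false

/-- `η^{x,+}`: a particle is created at `x` (if there is none). -/
def create {N : ℕ} (η : Config N) (x : Site N) : Config N := Function.update η x true

/-- The bulk generator with conductances `ω`. An edge `{x,y}` is listed once, as the pair with
`x < y`, and a pair that is not an edge has conductance `0`. -/
def bulkGen {N : ℕ} (ω : Site N → Site N → ℝ) (f : Config N → ℝ) (η : Config N) : ℝ :=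
  ∑ x : Site N, ∑ y : Site N, if x < y then
    ω x y * (occ η x * (1 - occ η y) * (f (move η x y) - f η)
      + occ η y * (1 - occ η x) * (f (move η y x) - f η))
  else 0

/-- The generator of a reservoir of density `ρ` acting at the site `x`. -/
def reservoirGen {N : ℕ} (x : Site N) (ρ : ℝ) (f : Config N → ℝ) (η : Config N) : ℝ :=
  occ η x * (1 - ρ) * (f (destroy η x) - f η)
    + ρ * (1 - occ η x) * (f (create η x) - f η)

/-- The infinitesimal generator of the boundary driven symmetric exclusion process with
conductances `ω` in the bulk and `ωL`, `ωR` to the reservoirs of densities `ρL`, `ρR`. -/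
def generator {N : ℕ} (hN : 2 ≤ N) (ω : Site N → Site N → ℝ) (ωL ωR ρL ρR : ℝ) :
    (Config N → ℝ) →ₗ[ℝ] (Config N → ℝ) where
  toFun f η := bulkGen ω f η + ωL * reservoirGen (leftSite hN) ρL f η
    + ωR * reservoirGen (rightSite hN) ρR f η
  map_add' f g := by
    have hb : ∀ η, bulkGen ω (f + g) η = bulkGen ω f η + bulkGen ω g η := by
      intro η
      simp only [bulkGen, ← Finset.sum_add_distrib]
      refine Finset.sum_congr rfl fun x _ => Finset.sum_congr rfl fun y _ => ?_
      split_ifs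
      · simp only [Pi.add_apply]; ring
      · simp
    funext η
    simp only [hb, reservoirGen, Pi.add_apply]
    ring
  map_smul' c f := by
    have hb : ∀ η, bulkGen ω (c • f) η = c * bulkGen ω f η := by
      intro η
      simp only [bulkGen, Finset.mul_sum]
      refine Finset.sum_congr rfl fun x _ => Finset.sum_congr rfl fun y _ => ?_
      split_ifs
      · simp only [Pi.smul_apply, smul_eq_mul]; ring
      · simp
    funext η
    simp only [hb, reservoirGen, Pi.smul_apply, smul_eq_mul, RingHom.id_apply]
    ring

/-- The Markov semigroup `P_t = exp (t L)` of the process with generator `L`: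
`(P_t f)(η)` is the expectation of `f(η_t)` for the process started from `η`. -/
def semigroup {N : ℕ} (L : (Config N → ℝ) →ₗ[ℝ] (Config N → ℝ)) (t : ℝ) :
    (Config N → ℝ) →L[ℝ] (Config N → ℝ) :=
  NormedSpace.exp (t • LinearMap.toContinuousLinearMap L)

/-- `μ` is a stationary distribution of the Markov process with generator `L`. -/
def IsStationary {N : ℕ} (L : (Config N → ℝ) →ₗ[ℝ] (Config N → ℝ))
    (μ : ProbabilityMeasure (Config N)) : Prop :=
  ∀ t : ℝ, 0 ≤ t → ∀ f : Config N → ℝ,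
    ∫ η, semigroup L t f η ∂(μ : Measure (Config N)) = ∫ η, f η ∂(μ : Measure (Config N))

/-- Conductances of the homogeneous segment: `ω_{x,y} = 1` if `|x - y| = 1` and `0` otherwise. -/
def segmentConductance {N : ℕ} (x y : Site N) : ℝ :=
  if |((x : ℕ) : ℤ) - ((y : ℕ) : ℤ)| = 1 then 1 else 0

open Classical in
/-- The index tuples `i_1 < … < i_j` in an `n`-element index set (indices start from `0`). -/
def increasing (j n : ℕ) : Finset (Fin j → Fin n) :=
  Finset.univ.filter fun i => StrictMono i

/-- `∏_{ℓ=1}^j (x_{i_ℓ} - (ℓ-1)) / (N - (ℓ-1))` (here `ℓ` starts from `0`). -/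
def tupleWeight {N n j : ℕ} (x : Fin n → Site N) (i : Fin j → Fin n) : ℝ :=
  ∏ l : Fin j, (((x (i l) : ℕ) : ℝ) - ((l : ℕ) : ℝ)) / ((N : ℝ) - ((l : ℕ) : ℝ))

/-- `ψ(x_1,…,x_n) = ∑_{j=0}^n (-1)^{n-j} ∑_{i_1<…<i_j} ∏_{ℓ=1}^j (x_{i_ℓ}-(ℓ-1))/(N-(ℓ-1))
∏_{r ∉ {i_1,…,i_j}} x_r/N`. -/
def psi {N n : ℕ} (x : Fin n → Site N) : ℝ :=
  ∑ j ∈ Finset.range (n + 1), (-1 : ℝ) ^ (n - j) * ∑ i ∈ increasing j n,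
    tupleWeight x i * ∏ r ∈ Finset.univ \ Finset.univ.image i, ((x r : ℕ) : ℝ) / (N : ℝ)

end OpenSEP

end

/-! The proof centres the occupation variables at `ρL`. The generator maps `∏_{x ∈ S} (η(x) - ρL)`
to exclusion swaps of `S`, pure killing at the left end, and at the right end killing plus `ρR - ρL`
times the product over `S` without `N-1` (`generator_shiftedProd`). Stationary expectations of these
products therefore solve a closed linear hierarchy graded by `|S|`. The hierarchy has the explicit
solution `(ρR - ρL)^|S| * weight S`: differences of `weight` across edges are `weight S` times a
gradient, so their sum telescopes and cancels the boundary terms (`weight_stationary`). A maximum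
principle makes the solution unique (`eq_of_stationary_equations`). Since centred products span all
functions of `η`, there is at most one stationary measure. One exists because a Markov generator on
a finite set has an invariant probability vector. Both formulas then come from expanding `∏ ((η(x_i)
- ρL) + b_i)` for suitable `b_i` (`expectation_prod_add`). -/

namespace OpenSEP

variable {N : ℕ}

/-! ### Edge sums and the action of the generator on centred products. -/

/-- Sum of `F x y` over the edges `{x, y}`, `x < y`, of the homogeneous segment. -/
noncomputable def edgeSum (F : Site N → Site N → ℝ) : ℝ :=
  ∑ x : Site N, ∑ y : Site N, if x < y then segmentConductance x y * F x y else 0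

/-- `∏_{x ∈ S} (η(x) - c)`. -/
noncomputable def shiftedProd (c : ℝ) (S : Finset (Site N)) (η : Config N) : ℝ :=
  ∏ x ∈ S, (occ η x - c)

/-- The set obtained from `S` by exchanging `x` and `y`. -/
def swapSet (x y : Site N) (S : Finset (Site N)) : Finset (Site N) :=
  S.map (Equiv.swap x y).toEmbedding

theorem mem_swapSet {x y z : Site N} {S : Finset (Site N)} :
    z ∈ swapSet x y S ↔ Equiv.swap x y z ∈ S := by
  simp [swapSet, Finset.mem_map_equiv]

theorem card_swapSet (x y : Site N) (S : Finset (Site N)) : (swapSet x y S).card = S.card :=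
  Finset.card_map _

theorem lt_and_segmentConductance {x y : Site N} :
    (x < y ∧ segmentConductance x y ≠ 0) ↔ (y : ℕ) = x + 1 := by
  unfold segmentConductance
  rw [← Subtype.coe_lt_coe]
  constructor
  · rintro ⟨h1, h2⟩
    have h3 : |((x : ℕ) : ℤ) - ((y : ℕ) : ℤ)| = 1 := by
      by_contra h
      simp [h] at h2
    rw [abs_of_neg (by omega)] at h3
    omega
  · intro h
    have h3 : |((x : ℕ) : ℤ) - ((y : ℕ) : ℤ)| = 1 := by
      rw [h]; push_cast
      simp
    exact ⟨by omega, by simp [h3]⟩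

theorem edgeSum_eq (F : Site N → Site N → ℝ) :
    edgeSum F = ∑ x : Site N, ∑ y : Site N, if (y : ℕ) = x + 1 then F x y else 0 := by
  refine Finset.sum_congr rfl fun x _ => Finset.sum_congr rfl fun y _ => ?_
  by_cases h : (y : ℕ) = x + 1
  · obtain ⟨h1, h2⟩ := lt_and_segmentConductance.2 h
    have h3 : segmentConductance x y = 1 := by
      unfold segmentConductance at h2 ⊢
      simpa using h2
    simp [h, h1, h3]
  · simp only [h, if_false]
    split_ifs with h1
    · have : segmentConductance x y = 0 := by
        by_contra h2
        exact h (lt_and_segmentConductance.1 ⟨h1, h2⟩)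
      simp [this]
    · rfl

theorem edgeSum_congr {F G : Site N → Site N → ℝ}
    (h : ∀ x y : Site N, (y : ℕ) = x + 1 → F x y = G x y) : edgeSum F = edgeSum G := by
  simp only [edgeSum_eq]
  refine Finset.sum_congr rfl fun x _ => Finset.sum_congr rfl fun y _ => ?_
  split_ifs with h1
  · exact h x y h1
  · rfl

theorem edgeSum_const_mul (c : ℝ) (F : Site N → Site N → ℝ) :
    edgeSum (fun x y => c * F x y) = c * edgeSum F := by
  simp only [edgeSum_eq, Finset.mul_sum, mul_ite, mul_zero]

theorem edgeSum_sub (F G : Site N → Site N → ℝ) :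
    edgeSum (fun x y => F x y - G x y) = edgeSum F - edgeSum G := by
  simp only [edgeSum_eq, ← Finset.sum_sub_distrib]
  refine Finset.sum_congr rfl fun x _ => Finset.sum_congr rfl fun y _ => ?_
  split_ifs <;> simp

/-- Every site except `N-1` is the lower end of exactly one edge, and every site except `1` is the
upper end of exactly one. For `N = 2` there are no edges and the two end sites coincide. -/
theorem edgeSum_telescope (hN : 2 ≤ N) (h : Site N → ℝ) :
    edgeSum (fun x y => h x - h y) = h (leftSite hN) - h (rightSite hN) := by
  have h1 : edgeSum (fun x _ => h x) = (∑ x, h x) - h (rightSite hN) := by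
    rw [edgeSum_eq, ← Finset.sum_erase (a := rightSite hN) Finset.univ,
      ← Finset.sum_erase_eq_sub (Finset.mem_univ _)]
    · refine Finset.sum_congr rfl fun x hx => ?_
      have hx1 := Finset.mem_Icc.1 x.2
      have hx2 : (x : ℕ) ≠ N - 1 := fun h => Finset.ne_of_mem_erase hx (Subtype.ext h)
      rw [Finset.sum_eq_single (⟨x + 1, Finset.mem_Icc.2 ⟨by omega, by omega⟩⟩ : Site N)]
      · simp
      · intro b _ hb
        rw [if_neg fun h => hb (Subtype.ext h)]
      · simp
    · refine Finset.sum_eq_zero fun y _ => if_neg ?_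
      have := Finset.mem_Icc.1 y.2
      simp only [rightSite]
      omega
  have h2 : edgeSum (fun _ y => h y) = (∑ x, h x) - h (leftSite hN) := by
    rw [edgeSum_eq, Finset.sum_comm, ← Finset.sum_erase (a := leftSite hN) Finset.univ,
      ← Finset.sum_erase_eq_sub (Finset.mem_univ _)]
    · refine Finset.sum_congr rfl fun y hy => ?_
      have hy1 := Finset.mem_Icc.1 y.2
      have hy2 : (y : ℕ) ≠ 1 := fun h => Finset.ne_of_mem_erase hy (Subtype.ext h)
      rw [Finset.sum_eq_single (⟨y - 1, Finset.mem_Icc.2 ⟨by omega, by omega⟩⟩ : Site N)]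
      · simp only
        rw [if_pos (by omega)]
      · intro b _ hb
        rw [if_neg fun h => hb (Subtype.ext (by simp only; omega))]
      · simp
    · refine Finset.sum_eq_zero fun y _ => if_neg ?_
      have := Finset.mem_Icc.1 y.2
      simp only [leftSite]
      omega
  rw [edgeSum_sub, h1, h2]
  ring

/-- If `η x = η y`, both jump rates vanish and the swap fixes `η`; otherwise exactly one jump is
allowed and it is the swap. -/
theorem bulkGen_segment (f : Config N → ℝ) (η : Config N) :
    bulkGen segmentConductance f η = edgeSum fun x y => f (η ∘ Equiv.swap x y) - f η := by
  refine Finset.sum_congr rfl fun x _ => Finset.sum_congr rfl fun y _ => ?_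
  split_ifs with hxy
  swap
  · rfl
  congr 1
  have hne : x ≠ y := hxy.ne
  have hmove : ∀ u v : Site N, u ≠ v → η u = true → η v = false →
      move η u v = η ∘ Equiv.swap u v := by
    intro u v huv hu hv
    funext z
    rw [move, if_pos hu, Function.comp_apply]
    by_cases hzv : z = v
    · subst hzv; simp [hu]
    · by_cases hzu : z = u
      · subst hzu; simp [huv, hv]
      · simp [hzv, hzu, Equiv.swap_apply_of_ne_of_ne hzu hzv]
  have hsame : η x = η y → η ∘ Equiv.swap x y = η := by
    intro h
    funext z
    rw [Function.comp_apply]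
    by_cases hzy : z = y
    · subst hzy; simp [h]
    · by_cases hzx : z = x
      · subst hzx; simp [h]
      · rw [Equiv.swap_apply_of_ne_of_ne hzx hzy]
  beta_reduce
  cases hx : η x <;> cases hy : η y
  · rw [hsame (by rw [hx, hy])]; simp [occ, hx, hy]
  · rw [hmove y x hne.symm hy hx, Equiv.swap_comm]; simp [occ, hx, hy]
  · rw [hmove x y hne hx hy]; simp [occ, hx, hy]
  · rw [hsame (by rw [hx, hy])]; simp [occ, hx, hy]

theorem shiftedProd_comp_swap (c : ℝ) (S : Finset (Site N)) (η : Config N) (x y : Site N) :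
    shiftedProd c S (η ∘ Equiv.swap x y) = shiftedProd c (swapSet x y S) η := by
  rw [shiftedProd, shiftedProd, swapSet, Finset.prod_map]
  rfl

theorem shiftedProd_update_of_notMem (c : ℝ) {S : Finset (Site N)} {x : Site N} (hx : x ∉ S)
    (η : Config N) (b : Bool) : shiftedProd c S (Function.update η x b) = shiftedProd c S η := by
  refine Finset.prod_congr rfl fun y hy => ?_
  have : y ≠ x := fun h => hx (h ▸ hy)
  simp [occ, this]

/-- Only the factor at `x` feels the reservoir, which relaxes `η(x) - c` to `ρ - c` at rate `1`. -/
theorem reservoirGen_shiftedProd (c ρ : ℝ) (S : Finset (Site N)) (x : Site N) (η : Config N) :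
    reservoirGen x ρ (shiftedProd c S) η =
      if x ∈ S then (ρ - c) * shiftedProd c (S.erase x) η - shiftedProd c S η else 0 := by
  split_ifs with hx
  · have key : ∀ ζ : Config N, shiftedProd c S ζ = (occ ζ x - c) * shiftedProd c (S.erase x) ζ :=
      fun ζ => (Finset.mul_prod_erase S (fun y => occ ζ y - c) hx).symm
    rw [reservoirGen, destroy, create, key η, key (Function.update _ _ _),
      key (Function.update _ _ _), shiftedProd_update_of_notMem c (Finset.notMem_erase x S),
      shiftedProd_update_of_notMem c (Finset.notMem_erase x S)]
    cases h : η x <;> simp [occ, h] <;> ring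
  · rw [reservoirGen, destroy, create, shiftedProd_update_of_notMem c hx,
      shiftedProd_update_of_notMem c hx]
    simp

/-- Centring at `ρL` removes the creation term on the left, so the only lower-order term comes from
the right end. -/
theorem generator_shiftedProd (hN : 2 ≤ N) (ρL ρR : ℝ) (S : Finset (Site N)) (η : Config N) :
    generator hN segmentConductance 1 1 ρL ρR (shiftedProd ρL S) η =
      edgeSum (fun x y => shiftedProd ρL (swapSet x y S) η - shiftedProd ρL S η)
      - (if leftSite hN ∈ S then shiftedProd ρL S η else 0)
      + (if rightSite hN ∈ S then
          (ρR - ρL) * shiftedProd ρL (S.erase (rightSite hN)) η - shiftedProd ρL S η else 0) := by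
  change bulkGen _ _ _ + 1 * reservoirGen _ _ _ _ + 1 * reservoirGen _ _ _ _ = _
  rw [bulkGen_segment, reservoirGen_shiftedProd, reservoirGen_shiftedProd]
  simp only [shiftedProd_comp_swap, sub_self, zero_mul]
  split_ifs <;> ring

/-! ### Ranks and the explicit product weight. -/

/-- The number of elements of `S` below `x`. -/
def rank (S : Finset (Site N)) (x : Site N) : ℕ := (S.filter (· < x)).card

/-- `∏_{x ∈ S} (x - rank x) / (N - rank x)`. -/
noncomputable def weight (S : Finset (Site N)) : ℝ :=
  ∏ x ∈ S, (((x : ℕ) : ℝ) - rank S x) / ((N : ℝ) - rank S x)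

/-- The elements of `S` below `x` inject into `{1, …, x-1}`. This keeps `x - rank` and `N - rank`
positive in all later divisions. -/
theorem rank_lt (S : Finset (Site N)) (x : Site N) : rank S x < x := by
  have hx := Finset.mem_Icc.1 x.2
  have h : rank S x ≤ (Finset.Ico 1 (x : ℕ)).card := by
    refine Finset.card_le_card_of_injOn (fun z => (z : ℕ)) ?_ Subtype.val_injective.injOn
    intro z hz
    have hz1 := Finset.mem_Icc.1 z.2
    have hz2 : (z : ℕ) < x := (Finset.mem_filter.1 hz).2
    simpa using ⟨hz1.1, hz2⟩
  rw [Nat.card_Ico] at h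
  omega

theorem sub_rank_pos (S : Finset (Site N)) (x : Site N) : 0 < ((x : ℕ) : ℝ) - rank S x :=
  sub_pos.2 (Nat.cast_lt.2 (rank_lt S x))

theorem card_sub_rank_pos (S : Finset (Site N)) (x : Site N) : 0 < (N : ℝ) - rank S x := by
  have hx := Finset.mem_Icc.1 x.2
  have := rank_lt S x
  exact sub_pos.2 (Nat.cast_lt.2 (by omega))

theorem rank_leftSite (hN : 2 ≤ N) (S : Finset (Site N)) : rank S (leftSite hN) = 0 := by
  have h := rank_lt S (leftSite hN)
  simp only [leftSite] at h ⊢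
  omega

theorem rank_succ {S : Finset (Site N)} {x y : Site N} (hxy : (y : ℕ) = x + 1) (hx : x ∈ S) :
    rank S y = rank S x + 1 := by
  have : S.filter (· < y) = insert x (S.filter (· < x)) := by
    ext z
    simp only [Finset.mem_filter, Finset.mem_insert, ← Subtype.coe_lt_coe, Subtype.ext_iff]
    constructor
    · rintro ⟨h1, h2⟩
      by_cases h : (z : ℕ) = x
      · exact Or.inl h
      · exact Or.inr ⟨h1, by omega⟩
    · rintro (h | h)
      · have : z = x := Subtype.ext h
        exact ⟨this ▸ hx, by omega⟩
      · exact ⟨h.1, by omega⟩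
  rw [rank, this, Finset.card_insert_of_notMem (by simp), rank]

/-- A particle moving to a vacant neighbour overtakes no other particle, so ranks are preserved and
only one numerator of `weight` changes. -/
theorem swap_lt_swap_iff {S : Finset (Site N)} {x y : Site N}
    (hxy : (y : ℕ) = x + 1 ∨ (x : ℕ) = y + 1) (hy : y ∉ S) {u z : Site N} (hu : u ∈ S)
    (hz : z ∈ S) : Equiv.swap x y u < Equiv.swap x y z ↔ u < z := by
  have huy : u ≠ y := fun h => hy (h ▸ hu)
  have hzy : z ≠ y := fun h => hy (h ▸ hz)
  have huy' : (u : ℕ) ≠ y := fun h => huy (Subtype.ext h)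
  have hzy' : (z : ℕ) ≠ y := fun h => hzy (Subtype.ext h)
  by_cases hux : u = x <;> by_cases hzx : z = x
  · subst hux; subst hzx; simp
  · have hzx' : (z : ℕ) ≠ x := fun h => hzx (Subtype.ext h)
    subst hux
    rw [Equiv.swap_apply_left, Equiv.swap_apply_of_ne_of_ne hzx hzy]
    simp only [← Subtype.coe_lt_coe]
    omega
  · have hux' : (u : ℕ) ≠ x := fun h => hux (Subtype.ext h)
    subst hzx
    rw [Equiv.swap_apply_left, Equiv.swap_apply_of_ne_of_ne hux huy]
    simp only [← Subtype.coe_lt_coe]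
    omega
  · rw [Equiv.swap_apply_of_ne_of_ne hux huy, Equiv.swap_apply_of_ne_of_ne hzx hzy]

theorem rank_swapSet {S : Finset (Site N)} {x y : Site N}
    (hxy : (y : ℕ) = x + 1 ∨ (x : ℕ) = y + 1) (hy : y ∉ S) {z : Site N} (hz : z ∈ S) :
    rank (swapSet x y S) (Equiv.swap x y z) = rank S z := by
  rw [rank, swapSet, Finset.filter_map, Finset.card_map, rank]
  congr 1
  refine Finset.filter_congr fun u hu => ?_
  exact swap_lt_swap_iff hxy hy hu hz

theorem weight_swapSet {S : Finset (Site N)} {x y : Site N}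
    (hxy : (y : ℕ) = x + 1 ∨ (x : ℕ) = y + 1) (hx : x ∈ S) (hy : y ∉ S) :
    weight (swapSet x y S) =
      weight S * ((((y : ℕ) : ℝ) - rank S x) / (((x : ℕ) : ℝ) - rank S x)) := by
  have h1 : weight (swapSet x y S) =
      ∏ z ∈ S, (((Equiv.swap x y z : ℕ) : ℝ) - rank S z) / ((N : ℝ) - rank S z) := by
    rw [weight]
    nth_rw 1 [swapSet]
    rw [Finset.prod_map]
    refine Finset.prod_congr rfl fun z hz => ?_
    rw [Equiv.coe_toEmbedding, rank_swapSet hxy hy hz]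
  rw [h1, weight, ← Finset.mul_prod_erase S _ hx, ← Finset.mul_prod_erase S _ hx,
    Equiv.swap_apply_left]
  have h2 : ∀ z ∈ S.erase x, (((Equiv.swap x y z : ℕ) : ℝ) - rank S z) / ((N : ℝ) - rank S z)
      = (((z : ℕ) : ℝ) - rank S z) / ((N : ℝ) - rank S z) := by
    intro z hz
    have hzy : z ≠ y := fun h => hy (h ▸ Finset.mem_of_mem_erase hz)
    rw [Equiv.swap_apply_of_ne_of_ne (Finset.ne_of_mem_erase hz) hzy]
  rw [Finset.prod_congr rfl h2]
  have := (sub_rank_pos S x).ne'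
  have := (card_sub_rank_pos S x).ne'
  field_simp

theorem swapSet_eq_self {S : Finset (Site N)} {x y : Site N} (h : x ∈ S ↔ y ∈ S) :
    swapSet x y S = S := by
  ext z
  rw [mem_swapSet]
  by_cases hx : z = x
  · subst hx; simp [h]
  · by_cases hy : z = y
    · subst hy; simp [h]
    · rw [Equiv.swap_apply_of_ne_of_ne hx hy]

/-- The logarithmic derivative of `weight` in the position of the particle at `x`. -/
noncomputable def slope (S : Finset (Site N)) (x : Site N) : ℝ :=
  if x ∈ S then 1 / (((x : ℕ) : ℝ) - rank S x) else 0

/-- When both sites are occupied the swap is trivial, and the two slopes agree because position and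
rank both increase by one. This is what the shift by the rank achieves. With one particle, its
numerator changes by `±1`. -/
theorem weight_swapSet_sub {S : Finset (Site N)} {x y : Site N} (hxy : (y : ℕ) = x + 1) :
    weight (swapSet x y S) - weight S = weight S * (slope S x - slope S y) := by
  have hxy' : ((y : ℕ) : ℝ) = ((x : ℕ) : ℝ) + 1 := by rw [hxy]; push_cast; rfl
  by_cases hx : x ∈ S <;> by_cases hy : y ∈ S
  · rw [swapSet_eq_self (by simp [hx, hy]), slope, slope, if_pos hx, if_pos hy, rank_succ hxy hx,
      hxy']
    push_cast
    ring
  · rw [weight_swapSet (Or.inl hxy) hx hy, slope, slope, if_pos hx, if_neg hy, hxy']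
    have := (sub_rank_pos S x).ne'
    field_simp
    ring
  · rw [swapSet, Equiv.swap_comm, ← swapSet, weight_swapSet (Or.inr hxy) hy hx, slope, slope,
      if_neg hx, if_pos hy]
    have := (sub_rank_pos S y).ne'
    rw [hxy'] at this ⊢
    field_simp
    ring
  · rw [swapSet_eq_self (by simp [hx, hy]), slope, slope, if_neg hx, if_neg hy]
    ring

/-- No site lies above `N-1`, so erasing it changes no other rank. With `r` its rank, the erased
factor is `(N-1-r)/(N-r)`. -/
theorem weight_erase_rightSite (hN : 2 ≤ N) {S : Finset (Site N)} (h : rightSite hN ∈ S) :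
    weight (S.erase (rightSite hN)) - weight S = weight S * slope S (rightSite hN) := by
  have h1 : weight (S.erase (rightSite hN)) = ∏ x ∈ S.erase (rightSite hN),
      (((x : ℕ) : ℝ) - rank S x) / ((N : ℝ) - rank S x) := by
    refine Finset.prod_congr rfl fun z _ => ?_
    have : rank (S.erase (rightSite hN)) z = rank S z := by
      rw [rank, rank]
      congr 1
      ext u
      simp only [Finset.mem_filter, Finset.mem_erase]
      refine ⟨fun hu => ⟨hu.1.2, hu.2⟩, fun hu => ⟨⟨?_, hu.1⟩, hu.2⟩⟩
      rintro rfl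
      have h2 : N - 1 < (z : ℕ) := hu.2
      have := Finset.mem_Icc.1 z.2
      omega
    rw [this]
  rw [h1, weight, ← Finset.mul_prod_erase S _ h, slope, if_pos h]
  have hc : (((rightSite hN : Site N) : ℕ) : ℝ) = (N : ℝ) - 1 := by
    simp only [rightSite]
    rw [Nat.cast_sub (by omega), Nat.cast_one]
  have ha := (sub_rank_pos S (rightSite hN)).ne'
  have hb := (card_sub_rank_pos S (rightSite hN)).ne'
  rw [hc] at ha ⊢
  field_simp
  ring

/-- The edge terms telescope to the slope at `1` minus the slope at `N-1`. The boundary terms are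
exactly these slopes with opposite signs; at site `1` the rank is `0`, so an occupied site has slope
`1`. -/
theorem weight_stationary (hN : 2 ≤ N) (S : Finset (Site N)) :
    edgeSum (fun x y => weight (swapSet x y S) - weight S)
      - (if leftSite hN ∈ S then weight S else 0)
      + (if rightSite hN ∈ S then weight (S.erase (rightSite hN)) - weight S else 0) = 0 := by
  have hL : (if leftSite hN ∈ S then weight S else 0) = weight S * slope S (leftSite hN) := by
    rw [slope, rank_leftSite]
    split_ifs <;> simp [leftSite]
  have hR : (if rightSite hN ∈ S then weight (S.erase (rightSite hN)) - weight S else 0)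
      = weight S * slope S (rightSite hN) := by
    split_ifs with h
    · exact weight_erase_rightSite hN h
    · rw [slope, if_neg h, mul_zero]
  rw [edgeSum_congr (G := fun x y => weight S * (slope S x - slope S y))
    (fun x y h => weight_swapSet_sub h), edgeSum_const_mul, edgeSum_telescope hN, hL, hR]
  ring

theorem pow_card_mul_weight_stationary (hN : 2 ≤ N) (d : ℝ) (S : Finset (Site N)) :
    edgeSum (fun x y => d ^ (swapSet x y S).card * weight (swapSet x y S)
        - d ^ S.card * weight S)
      - (if leftSite hN ∈ S then d ^ S.card * weight S else 0)
      + (if rightSite hN ∈ S then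
          d * (d ^ (S.erase (rightSite hN)).card * weight (S.erase (rightSite hN)))
            - d ^ S.card * weight S else 0) = 0 := by
  have h := congrArg (d ^ S.card * ·) (weight_stationary hN S)
  simp only [mul_zero] at h
  rw [mul_add, mul_sub, ← edgeSum_const_mul] at h
  simp only [card_swapSet, ← mul_sub]
  refine Eq.trans ?_ h
  rw [mul_ite, mul_ite, mul_zero]
  congr 1
  by_cases hR : rightSite hN ∈ S
  · rw [if_pos hR, if_pos hR, ← mul_assoc, ← pow_succ', Finset.card_erase_add_one hR, mul_sub]
  · rw [if_neg hR, if_neg hR]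

/-! ### Maximum principle and uniqueness for the hierarchy. -/

/-- Maximum principle for exclusion particles killed at the two ends of the segment. -/
theorem nonpos_of_killed_harmonic (hN : 2 ≤ N) {k : ℕ} (hk : k ≠ 0) (F : Finset (Site N) → ℝ)
    (hF : ∀ S : Finset (Site N), S.card = k → edgeSum (fun x y => F (swapSet x y S) - F S)
      - (if leftSite hN ∈ S then F S else 0) - (if rightSite hN ∈ S then F S else 0) = 0)
    (S : Finset (Site N)) (hS : S.card = k) : F S ≤ 0 := by
  obtain ⟨M, hM, hmax⟩ := Finset.exists_max_image (Finset.powersetCard k Finset.univ) F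
    ⟨S, Finset.mem_powersetCard.2 ⟨Finset.subset_univ S, hS⟩⟩
  simp only [Finset.mem_powersetCard, Finset.subset_univ, true_and] at hM hmax
  refine (hmax S hS).trans ?_
  by_contra! hpos
  -- No maximiser contains site `n + 1`. At site `1` the killing term is strictly negative; a
  -- particle further right can be moved one step left without leaving the set of maximisers.
  have key : ∀ n : ℕ, ∀ T : Finset (Site N), T.card = k → F T = F M →
      ∀ x ∈ T, (x : ℕ) ≠ n + 1 := by
    intro n
    induction n with
    | zero =>
      intro T hT hTM x hx hx1
      have hl : leftSite hN ∈ T := by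
        have : x = leftSite hN := Subtype.ext hx1
        exact this ▸ hx
      have h := hF T hT
      have h1 : edgeSum (fun x y => F (swapSet x y T) - F T) ≤ 0 := by
        rw [edgeSum_eq]
        refine Finset.sum_nonpos fun x _ => Finset.sum_nonpos fun y _ => ?_
        split_ifs
        · exact sub_nonpos.2 (hTM ▸ hmax _ ((card_swapSet x y T).trans hT))
        · exact le_rfl
      rw [if_pos hl] at h
      split_ifs at h <;> linarith
    | succ n ih =>
      intro T hT hTM x hx hx1
      have hxN := Finset.mem_Icc.1 x.2
      let w : Site N := ⟨n + 1, Finset.mem_Icc.2 ⟨by omega, by omega⟩⟩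
      have h := hF T hT
      have hnp : ∀ x y : Site N, (if (y : ℕ) = x + 1 then F (swapSet x y T) - F T else 0) ≤ 0 := by
        intro x y
        split_ifs
        · exact sub_nonpos.2 (hTM ▸ hmax _ ((card_swapSet x y T).trans hT))
        · exact le_rfl
      have h1 : edgeSum (fun x y => F (swapSet x y T) - F T) ≤ F (swapSet w x T) - F T := by
        rw [edgeSum_eq]
        -- At a maximiser all edge terms are nonpositive, so all but the one of the edge `{w, x}`
        -- may be dropped.
        calc _ ≤ ∑ y : Site N, if (y : ℕ) = w + 1 then F (swapSet w y T) - F T else 0 := by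
              rw [← Finset.add_sum_erase _ _ (Finset.mem_univ w)]
              exact add_le_of_nonpos_right
                (Finset.sum_nonpos fun u _ => Finset.sum_nonpos fun y _ => hnp u y)
          _ ≤ if (x : ℕ) = w + 1 then F (swapSet w x T) - F T else 0 := by
              rw [← Finset.add_sum_erase _ _ (Finset.mem_univ x)]
              exact add_le_of_nonpos_right (Finset.sum_nonpos fun y _ => hnp w y)
          _ = _ := if_pos hx1
      have h2 : F (swapSet w x T) = F M := by
        refine le_antisymm (hmax _ ((card_swapSet w x T).trans hT)) ?_
        split_ifs at h <;> linarith
      exact ih _ ((card_swapSet w x T).trans hT) h2 w (by simpa [mem_swapSet] using hx) rfl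
  obtain ⟨x, hx⟩ := Finset.card_ne_zero.1 (hM ▸ hk)
  have hx1 := Finset.mem_Icc.1 x.2
  exact key (x - 1) M hM rfl x hx (by omega)

/-- The stationarity equations have at most one solution with a given value at `∅`. -/
theorem eq_of_stationary_equations (hN : 2 ≤ N) (d : ℝ) (F G : Finset (Site N) → ℝ)
    (h0 : F ∅ = G ∅)
    (hF : ∀ S, edgeSum (fun x y => F (swapSet x y S) - F S) - (if leftSite hN ∈ S then F S else 0)
      + (if rightSite hN ∈ S then d * F (S.erase (rightSite hN)) - F S else 0) = 0)
    (hG : ∀ S, edgeSum (fun x y => G (swapSet x y S) - G S) - (if leftSite hN ∈ S then G S else 0)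
      + (if rightSite hN ∈ S then d * G (S.erase (rightSite hN)) - G S else 0) = 0) :
    F = G := by
  have key : ∀ k, ∀ S : Finset (Site N), S.card = k → F S = G S := by
    intro k
    induction k with
    | zero => intro S hS; rw [Finset.card_eq_zero.1 hS, h0]
    | succ k ih =>
      -- The lower-order terms of two solutions agree by induction, so their difference is harmonic
      -- for the killed dynamics. The claim is used in both orders.
      have step : ∀ A B : Finset (Site N) → ℝ, (∀ S, S.card = k → A S = B S) →
          (∀ S, edgeSum (fun x y => A (swapSet x y S) - A S)
            - (if leftSite hN ∈ S then A S else 0)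
            + (if rightSite hN ∈ S then d * A (S.erase (rightSite hN)) - A S else 0) = 0) →
          (∀ S, edgeSum (fun x y => B (swapSet x y S) - B S)
            - (if leftSite hN ∈ S then B S else 0)
            + (if rightSite hN ∈ S then d * B (S.erase (rightSite hN)) - B S else 0) = 0) →
          ∀ S, S.card = k + 1 → A S - B S ≤ 0 := by
        intro A B hAB hA hB
        refine nonpos_of_killed_harmonic hN k.succ_ne_zero (fun S => A S - B S) fun S hS => ?_
        have h1 := hA S
        have h2 := hB S
        have h3 : edgeSum (fun x y => (A (swapSet x y S) - B (swapSet x y S)) - (A S - B S)) =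
            edgeSum (fun x y => A (swapSet x y S) - A S)
              - edgeSum (fun x y => B (swapSet x y S) - B S) := by
          rw [← edgeSum_sub]
          exact edgeSum_congr fun x y _ => by ring
        rw [h3]
        by_cases hR : rightSite hN ∈ S
        · rw [if_pos hR] at h1 h2 ⊢
          rw [hAB (S.erase (rightSite hN)) (by rw [Finset.card_erase_of_mem hR, hS]; rfl)] at h1
          split_ifs at h1 h2 ⊢ <;> linarith
        · rw [if_neg hR] at h1 h2 ⊢
          split_ifs at h1 h2 ⊢ <;> linarith
      intro S hS
      have h1 := step F G ih hF hG S hS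
      have h2 := step G F (fun S hS => (ih S hS).symm) hG hF S hS
      linarith
  exact funext fun S => key _ S rfl

/-! ### Stationarity in terms of the generator. -/

/-- Integration against `ν` as a continuous linear functional. -/
noncomputable def expectation (ν : ProbabilityMeasure (Config N)) : (Config N → ℝ) →L[ℝ] ℝ :=
  LinearMap.toContinuousLinearMap
    { toFun := fun f => ∫ η, f η ∂(ν : Measure (Config N))
      map_add' := fun f g => integral_add (f := f) (g := g) .of_finite .of_finite
      map_smul' := fun c f => integral_smul (μ := (ν : Measure (Config N))) c f }

theorem expectation_apply (ν : ProbabilityMeasure (Config N)) (f : Config N → ℝ) :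
    expectation ν f = ∫ η, f η ∂(ν : Measure (Config N)) := rfl

/-- The generator stands outside the semigroup, so a measure that annihilates its range gives
derivative zero at every time. -/
theorem hasDerivAt_expectation_semigroup (L : (Config N → ℝ) →ₗ[ℝ] (Config N → ℝ))
    (ν : ProbabilityMeasure (Config N)) (f : Config N → ℝ) (t : ℝ) :
    HasDerivAt (fun u => expectation ν (semigroup L u f))
      (expectation ν (L (semigroup L t f))) t := by
  have h := hasDerivAt_exp_smul_const' (𝕂 := ℝ) (LinearMap.toContinuousLinearMap L) t
  exact (expectation ν).hasFDerivAt.comp_hasDerivAt t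
    (((ContinuousLinearMap.apply ℝ (Config N → ℝ) f).hasFDerivAt).comp_hasDerivAt t h)

theorem semigroup_zero (L : (Config N → ℝ) →ₗ[ℝ] (Config N → ℝ)) (f : Config N → ℝ) :
    semigroup L 0 f = f := by
  simp [semigroup, NormedSpace.exp_zero]

/-- A measure is stationary if and only if it annihilates the range of the generator. -/
theorem isStationary_iff (L : (Config N → ℝ) →ₗ[ℝ] (Config N → ℝ))
    (ν : ProbabilityMeasure (Config N)) :
    IsStationary L ν ↔ ∀ f, expectation ν (L f) = 0 := by
  constructor
  · intro h f
    -- Stationarity concerns only `t ≥ 0`, hence the one-sided derivative at `0`.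
    have h1 := (hasDerivAt_expectation_semigroup L ν f 0).hasDerivWithinAt (s := Set.Ici 0)
    rw [semigroup_zero] at h1
    have h2 : HasDerivWithinAt (fun u => expectation ν (semigroup L u f)) 0 (Set.Ici 0) 0 := by
      refine (hasDerivWithinAt_const (0 : ℝ) (Set.Ici 0) (expectation ν f)).congr
        (fun t ht => h t ht f) (h 0 le_rfl f)
    exact UniqueDiffWithinAt.eq_deriv _ (uniqueDiffWithinAt_Ici 0) h1 h2
  · intro h t _ f
    have hd := hasDerivAt_expectation_semigroup L ν f
    have hc := is_const_of_deriv_eq_zero (fun u => (hd u).differentiableAt)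
      (fun u => by rw [(hd u).deriv, h]) t 0
    rw [semigroup_zero] at hc
    exact hc

/-! ### Existence of a stationary distribution. -/

theorem generator_one (hN : 2 ≤ N) (ω : Site N → Site N → ℝ) (ωL ωR ρL ρR : ℝ) :
    generator hN ω ωL ωR ρL ρR 1 = 0 := by
  funext η
  change bulkGen _ _ _ + ωL * reservoirGen _ _ _ _ + ωR * reservoirGen _ _ _ _ = _
  simp [bulkGen, reservoirGen]

theorem occ_nonneg (η : Config N) (x : Site N) : 0 ≤ occ η x := by
  unfold occ; split_ifs <;> norm_num

theorem occ_le_one (η : Config N) (x : Site N) : occ η x ≤ 1 := by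
  unfold occ; split_ifs <;> norm_num

theorem generator_nonneg (hN : 2 ≤ N) {ρL ρR : ℝ} (hρL : ρL ∈ Set.Ioo (0 : ℝ) 1)
    (hρR : ρR ∈ Set.Ioo (0 : ℝ) 1) {f : Config N → ℝ} (hf : ∀ η, 0 ≤ f η) {η : Config N}
    (hη : f η = 0) : 0 ≤ generator hN segmentConductance 1 1 ρL ρR f η := by
  have hres : ∀ x : Site N, ∀ ρ ∈ Set.Ioo (0 : ℝ) 1, 0 ≤ reservoirGen x ρ f η := by
    intro x ρ hρ
    rw [reservoirGen, hη, sub_zero, sub_zero]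
    have h1 := occ_nonneg η x
    have h2 := sub_nonneg.2 (occ_le_one η x)
    have h3 := hρ.1.le
    have h4 := sub_nonneg.2 hρ.2.le
    have h5 := hf (destroy η x)
    have h6 := hf (create η x)
    positivity
  change 0 ≤ bulkGen _ _ _ + 1 * reservoirGen _ _ _ _ + 1 * reservoirGen _ _ _ _
  rw [one_mul, one_mul]
  refine add_nonneg (add_nonneg ?_ (hres _ _ hρL)) (hres _ _ hρR)
  rw [bulkGen_segment, edgeSum_eq]
  refine Finset.sum_nonneg fun x _ => Finset.sum_nonneg fun y _ => ?_
  split_ifs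
  · rw [hη, sub_zero]; exact hf _
  · exact le_rfl

/-- A Markov generator on a finite set has an invariant probability vector. -/
theorem exists_invariant_vector {α : Type*} [Fintype α] [DecidableEq α] [Nonempty α]
    (L : (α → ℝ) →ₗ[ℝ] (α → ℝ)) (hone : L 1 = 0)
    (hpos : ∀ f : α → ℝ, (∀ a, 0 ≤ f a) → ∀ a, f a = 0 → 0 ≤ L f a) :
    ∃ p : α → ℝ, (∀ a, 0 ≤ p a) ∧ ∑ a, p a = 1 ∧ ∀ f, ∑ a, p a * L f a = 0 := by
  have expand : ∀ (φ : (α → ℝ) →ₗ[ℝ] ℝ) (f : α → ℝ),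
      φ f = ∑ b, f b * φ (Pi.single b 1) := by
    intro φ f
    conv_lhs => rw [pi_eq_sum_univ' f]
    rw [map_sum]
    refine Finset.sum_congr rfl fun b _ => ?_
    rw [map_smul, smul_eq_mul]
  -- As `L` kills `1`, it is not injective, hence not surjective in finite dimension. A nonzero
  -- functional vanishing on its range is a left null vector `v`.
  have hlt : L.range < ⊤ := by
    refine lt_top_iff_ne_top.2 fun h => ?_
    have hinj := LinearMap.injective_iff_surjective.2 (LinearMap.range_eq_top.1 h)
    have h10 : (1 : α → ℝ) = 0 := hinj (by rw [hone, map_zero])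
    exact one_ne_zero (congrFun h10 (Classical.arbitrary α))
  obtain ⟨φ, hφ, hker⟩ := Submodule.exists_le_ker_of_lt_top _ hlt
  set v : α → ℝ := fun a => φ (Pi.single a 1) with hv
  have hv0 : ∀ f, ∑ a, v a * L f a = 0 := by
    intro f
    have h : φ (L f) = 0 := hker ⟨f, rfl⟩
    rw [expand] at h
    rw [← h]
    exact Finset.sum_congr rfl fun a _ => mul_comm _ _
  have hoff : ∀ a b, a ≠ b → 0 ≤ L (Pi.single b 1) a := by
    intro a b hab
    refine hpos _ (fun c => ?_) a (by simp [hab])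
    rw [Pi.single_apply]
    split_ifs <;> norm_num
  have hrow : ∀ a, ∑ b, L (Pi.single b 1) a = 0 := by
    intro a
    have h := expand ((LinearMap.proj a).comp L) 1
    simp only [LinearMap.comp_apply, LinearMap.proj_apply, Pi.one_apply, one_mul, hone,
      Pi.zero_apply] at h
    exact h.symm
  have hdiag : ∀ a, L (Pi.single a 1) a ≤ 0 := by
    intro a
    have h := hrow a
    rw [← Finset.add_sum_erase _ _ (Finset.mem_univ a)] at h
    have h2 : 0 ≤ ∑ b ∈ Finset.univ.erase a, L (Pi.single b 1) a :=
      Finset.sum_nonneg fun b hb => hoff a b (Finset.ne_of_mem_erase hb).symm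
    linarith
  -- Isolating the diagonal term of `v L = 0`, the triangle inequality shows that every entry of
  -- `|v| L` is nonnegative. Zero row sums make these entries add up to zero, so `|v|` is also a
  -- left null vector.
  have habs : ∀ b, 0 ≤ ∑ a, |v a| * L (Pi.single b 1) a := by
    intro b
    have h := hv0 (Pi.single b 1)
    rw [← Finset.add_sum_erase _ _ (Finset.mem_univ b)] at h ⊢
    have h1 : |v b * L (Pi.single b 1) b| ≤
        ∑ a ∈ Finset.univ.erase b, |v a| * L (Pi.single b 1) a := by
      rw [eq_neg_of_add_eq_zero_left h, abs_neg]
      refine (Finset.abs_sum_le_sum_abs _ _).trans_eq (Finset.sum_congr rfl fun a ha => ?_)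
      rw [abs_mul, abs_of_nonneg (hoff a b (Finset.ne_of_mem_erase ha))]
    rw [abs_mul, abs_of_nonpos (hdiag b)] at h1
    linarith
  have hzero : ∀ b, ∑ a, |v a| * L (Pi.single b 1) a = 0 := by
    have h : ∑ b, ∑ a, |v a| * L (Pi.single b 1) a = 0 := by
      rw [Finset.sum_comm]
      refine Finset.sum_eq_zero fun a _ => ?_
      rw [← Finset.mul_sum, hrow, mul_zero]
    intro b
    exact (Finset.sum_eq_zero_iff_of_nonneg fun b _ => habs b).1 h b (Finset.mem_univ b)
  have hsum : 0 < ∑ a, |v a| := by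
    refine lt_of_le_of_ne (Finset.sum_nonneg fun a _ => abs_nonneg _) fun h => hφ ?_
    have hva : ∀ a, v a = 0 := fun a => abs_eq_zero.1
      ((Finset.sum_eq_zero_iff_of_nonneg fun a _ => abs_nonneg (v a)).1 h.symm a
        (Finset.mem_univ a))
    ext f
    simpa using hva f
  refine ⟨fun a => |v a| / ∑ b, |v b|, fun a => div_nonneg (abs_nonneg _) hsum.le, ?_, fun f => ?_⟩
  · rw [← Finset.sum_div, div_self hsum.ne']
  · have h : ∑ a, |v a| * L f a = 0 := by
      have hL : ∀ a, L f a = ∑ b, f b * L (Pi.single b 1) a := fun a =>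
        expand ((LinearMap.proj a).comp L) f
      simp only [hL, Finset.mul_sum]
      rw [Finset.sum_comm]
      refine Finset.sum_eq_zero fun b _ => ?_
      rw [← mul_zero (f b), ← hzero b, Finset.mul_sum]
      exact Finset.sum_congr rfl fun a _ => by ring
    simp only [div_mul_eq_mul_div]
    rw [← Finset.sum_div, h, zero_div]

theorem exists_isStationary (hN : 2 ≤ N) {ρL ρR : ℝ} (hρL : ρL ∈ Set.Ioo (0 : ℝ) 1)
    (hρR : ρR ∈ Set.Ioo (0 : ℝ) 1) :
    ∃ μ : ProbabilityMeasure (Config N),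
      IsStationary (generator hN segmentConductance 1 1 ρL ρR) μ := by
  obtain ⟨p, hp0, hp1, hp⟩ := exists_invariant_vector
    (generator hN segmentConductance 1 1 ρL ρR) (generator_one hN _ _ _ _ _)
    (fun f hf a ha => generator_nonneg hN hρL hρR hf ha)
  let q : PMF (Config N) := PMF.ofFintype (fun η => ENNReal.ofReal (p η)) (by
    rw [← ENNReal.ofReal_sum_of_nonneg fun η _ => hp0 η, hp1, ENNReal.ofReal_one])
  refine ⟨⟨q.toMeasure, inferInstance⟩, (isStationary_iff _ _).2 fun f => ?_⟩
  change ∫ η, _ ∂q.toMeasure = 0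
  rw [PMF.integral_eq_sum, ← hp f]
  refine Finset.sum_congr rfl fun η _ => ?_
  rw [PMF.ofFintype_apply, ENNReal.toReal_ofReal (hp0 η), smul_eq_mul]

/-! ### Stationary correlations and uniqueness of the measure. -/

theorem expectation_edgeSum (ν : ProbabilityMeasure (Config N))
    (F : Site N → Site N → Config N → ℝ) :
    expectation ν (fun η => edgeSum fun x y => F x y η) =
      edgeSum fun x y => expectation ν (F x y) := by
  simp only [edgeSum_eq]
  have : (fun η => ∑ x : Site N, ∑ y : Site N, if (y : ℕ) = x + 1 then F x y η else 0) =
      ∑ x : Site N, ∑ y : Site N, if (y : ℕ) = x + 1 then F x y else 0 := by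
    funext η
    rw [Finset.sum_apply]
    refine Finset.sum_congr rfl fun x _ => ?_
    rw [Finset.sum_apply]
    refine Finset.sum_congr rfl fun y _ => ?_
    split_ifs <;> rfl
  rw [this, map_sum]
  refine Finset.sum_congr rfl fun x _ => ?_
  rw [map_sum]
  refine Finset.sum_congr rfl fun y _ => ?_
  split_ifs <;> simp

/-- The correlations of the variables `η(x) - ρL` under a stationary distribution. -/
theorem expectation_shiftedProd (hN : 2 ≤ N) {ρL ρR : ℝ} {ν : ProbabilityMeasure (Config N)}
    (hν : IsStationary (generator hN segmentConductance 1 1 ρL ρR) ν) (S : Finset (Site N)) :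
    expectation ν (shiftedProd ρL S) = (ρR - ρL) ^ S.card * weight S := by
  suffices hsuff : (fun S => expectation ν (shiftedProd ρL S)) =
      fun S : Finset (Site N) => (ρR - ρL) ^ S.card * weight S from congrFun hsuff S
  refine eq_of_stationary_equations hN (ρR - ρL) _ _ ?_ (fun S => ?_)
    (pow_card_mul_weight_stationary hN (ρR - ρL))
  · rw [expectation_apply]
    simp [shiftedProd, weight]
  · have h := (isStationary_iff _ _).1 hν (shiftedProd ρL S)
    have hg : generator hN segmentConductance 1 1 ρL ρR (shiftedProd ρL S) =
        (fun η => edgeSum fun x y => (shiftedProd ρL (swapSet x y S) - shiftedProd ρL S) η)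
        - (if leftSite hN ∈ S then shiftedProd ρL S else 0)
        + (if rightSite hN ∈ S then
          (ρR - ρL) • shiftedProd ρL (S.erase (rightSite hN)) - shiftedProd ρL S else 0) := by
      funext η
      rw [generator_shiftedProd, Pi.add_apply, Pi.sub_apply]
      split_ifs <;> rfl
    rw [hg, map_add, map_sub, expectation_edgeSum] at h
    simp only [map_sub] at h
    refine Eq.trans ?_ h
    congr 2
    · split_ifs <;> simp
    · split_ifs <;> simp

/-- The indicator of a configuration, in terms of the variables `η(x) - c`. -/
theorem indicator_eq_sum_shiftedProd (c : ℝ) (ξ : Config N) :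
    ∃ a : Finset (Site N) → ℝ, (fun η => if η = ξ then (1 : ℝ) else 0) =
      ∑ S, a S • shiftedProd c S := by
  -- At each site `s x * (η(x) - c) + t x` is the indicator of `η x = ξ x`, that is `η(x)` or `1 -
  -- η(x)`.
  let s : Site N → ℝ := fun x => if ξ x = true then 1 else -1
  let t : Site N → ℝ := fun x => if ξ x = true then c else 1 - c
  refine ⟨fun S => (∏ x ∈ S, s x) * ∏ x ∈ Finset.univ \ S, t x, ?_⟩
  funext η
  have h1 : (if η = ξ then (1 : ℝ) else 0) = ∏ x, (s x * (occ η x - c) + t x) := by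
    split_ifs with h
    · subst h
      symm
      refine Finset.prod_eq_one fun x _ => ?_
      by_cases hx : η x = true <;> simp [s, t, occ, hx]
    · obtain ⟨x, hx⟩ := Function.ne_iff.1 h
      symm
      refine Finset.prod_eq_zero (Finset.mem_univ x) ?_
      cases h1 : η x <;> cases h2 : ξ x <;> simp_all [s, t, occ]
  rw [h1, Finset.prod_add, Finset.powerset_univ, Finset.sum_apply]
  refine Finset.sum_congr rfl fun S _ => ?_
  rw [Finset.prod_mul_distrib, Pi.smul_apply, smul_eq_mul, shiftedProd]
  ring

/-- Point masses are expectations of combinations of centred products, whose values do not depend on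
the stationary measure. -/
theorem IsStationary.unique (hN : 2 ≤ N) {ρL ρR : ℝ} {μ ν : ProbabilityMeasure (Config N)}
    (hμ : IsStationary (generator hN segmentConductance 1 1 ρL ρR) μ)
    (hν : IsStationary (generator hN segmentConductance 1 1 ρL ρR) ν) : ν = μ := by
  refine Subtype.ext (Measure.ext_of_singleton fun ξ => ?_)
  have hsingle : ∀ κ : ProbabilityMeasure (Config N),
      expectation κ (fun η => if η = ξ then (1 : ℝ) else 0) = (κ : Measure (Config N)).real {ξ} := by
    intro κ
    rw [expectation_apply, ← integral_indicator_one (measurableSet_singleton ξ)]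
    congr 1
    funext η
    by_cases h : η = ξ <;> simp [h]
  have h : (ν : Measure (Config N)).real {ξ} = (μ : Measure (Config N)).real {ξ} := by
    rw [← hsingle, ← hsingle]
    obtain ⟨a, ha⟩ := indicator_eq_sum_shiftedProd ρL ξ
    rw [ha, map_sum, map_sum]
    refine Finset.sum_congr rfl fun S _ => ?_
    rw [map_smul, map_smul, expectation_shiftedProd hN hμ, expectation_shiftedProd hN hν]
  exact (measureReal_eq_measureReal_iff (measure_ne_top (ν : Measure (Config N)) _)
    (measure_ne_top (μ : Measure (Config N)) _)).1 h

/-! ### From finite sets to increasing index tuples, and the two formulas. -/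

theorem mem_increasing {j n : ℕ} {i : Fin j → Fin n} : i ∈ increasing j n ↔ StrictMono i := by
  simp [increasing]

theorem sum_increasing {j n : ℕ} (f : Finset (Fin n) → ℝ) :
    ∑ i ∈ increasing j n, f (Finset.univ.image i) =
      ∑ T ∈ Finset.powersetCard j Finset.univ, f T := by
  refine Finset.sum_bij (fun i _ => Finset.univ.image i) (fun i hi => ?_) (fun i hi k hk h => ?_)
    (fun T hT => ?_) (fun _ _ => rfl)
  · rw [Finset.mem_powersetCard]
    refine ⟨Finset.subset_univ _, ?_⟩
    rw [Finset.card_image_of_injective _ (mem_increasing.1 hi).injective, Finset.card_univ,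
      Fintype.card_fin]
  · refine (StrictMono.range_inj (mem_increasing.1 hi) (mem_increasing.1 hk)).1 ?_
    simpa using congrArg (fun s : Finset (Fin n) => (s : Set (Fin n))) h
  · have hc := (Finset.mem_powersetCard.1 hT).2
    refine ⟨T.orderEmbOfFin hc, mem_increasing.2 (T.orderEmbOfFin hc).strictMono, ?_⟩
    exact Finset.image_orderEmbOfFin_univ T hc

/-- In an increasing enumeration counted from `0`, the rank of a point is its index. -/
theorem weight_image {k : ℕ} {y : Fin k → Site N} (hy : StrictMono y) :
    weight (Finset.univ.image y) =
      ∏ l : Fin k, (((y l : ℕ) : ℝ) - ((l : ℕ) : ℝ)) / ((N : ℝ) - ((l : ℕ) : ℝ)) := by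
  rw [weight, Finset.prod_image hy.injective.injOn]
  refine Finset.prod_congr rfl fun l _ => ?_
  have : rank (Finset.univ.image y) (y l) = l := by
    rw [rank, Finset.filter_image, Finset.card_image_of_injective _ hy.injective]
    simp only [hy.lt_iff_lt]
    rw [Finset.filter_gt_eq_Iio, Fin.card_Iio]
  rw [this]

theorem weight_image_image {n j : ℕ} {x : Fin n → Site N} (hx : StrictMono x) {i : Fin j → Fin n}
    (hi : StrictMono i) : weight ((Finset.univ.image i).image x) = tupleWeight x i := by
  rw [Finset.image_image, weight_image (hx.comp hi)]
  rfl

theorem weight_singleton (y : Site N) : weight {y} = ((y : ℕ) : ℝ) / N := by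
  simp [weight, rank, Finset.filter_singleton]

/-- Expansion of `E[∏ (η(x_i) - ρL + b_i)]` over increasing index tuples. -/
theorem expectation_prod_add (hN : 2 ≤ N) {ρL ρR : ℝ} {μ : ProbabilityMeasure (Config N)}
    (hμ : IsStationary (generator hN segmentConductance 1 1 ρL ρR) μ) {n : ℕ}
    {x : Fin n → Site N} (hx : StrictMono x) (b : Fin n → ℝ) :
    expectation μ (fun η => ∏ i, ((occ η (x i) - ρL) + b i)) =
      ∑ j ∈ Finset.range (n + 1), (ρR - ρL) ^ j * ∑ i ∈ increasing j n,
        tupleWeight x i * ∏ r ∈ Finset.univ \ Finset.univ.image i, b r := by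
  have h : (fun η : Config N => ∏ i, ((occ η (x i) - ρL) + b i)) =
      ∑ T : Finset (Fin n), (∏ r ∈ Finset.univ \ T, b r) • shiftedProd ρL (T.image x) := by
    funext η
    rw [Finset.prod_add, Finset.powerset_univ, Finset.sum_apply]
    refine Finset.sum_congr rfl fun T _ => ?_
    rw [Pi.smul_apply, smul_eq_mul, shiftedProd, Finset.prod_image hx.injective.injOn, mul_comm]
  rw [h, map_sum, ← Finset.powerset_univ, Finset.sum_powerset, Finset.card_univ, Fintype.card_fin]
  refine Finset.sum_congr rfl fun j _ => ?_
  rw [← sum_increasing, Finset.mul_sum]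
  refine Finset.sum_congr rfl fun i hi => ?_
  have hi' := mem_increasing.1 hi
  rw [map_smul, expectation_shiftedProd hN hμ, weight_image_image hx hi', smul_eq_mul,
    Finset.card_image_of_injective _ hx.injective, Finset.card_image_of_injective _ hi'.injective,
    Finset.card_univ, Fintype.card_fin]
  ring

theorem card_compl_image {j n : ℕ} {i : Fin j → Fin n} (hi : i ∈ increasing j n) :
    (Finset.univ \ Finset.univ.image i).card = n - j := by
  rw [Finset.card_sdiff_of_subset (Finset.subset_univ _),
    Finset.card_image_of_injective _ (mem_increasing.1 hi).injective]
  simp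

theorem expectation_occ (hN : 2 ≤ N) {ρL ρR : ℝ} {μ : ProbabilityMeasure (Config N)}
    (hμ : IsStationary (generator hN segmentConductance 1 1 ρL ρR) μ) (y : Site N) :
    ∫ η, occ η y ∂(μ : Measure (Config N)) = ρL + (ρR - ρL) * (((y : ℕ) : ℝ) / N) := by
  have h := expectation_shiftedProd hN hμ {y}
  rw [weight_singleton, Finset.card_singleton, pow_one] at h
  rw [← h, expectation_apply]
  simp only [shiftedProd, Finset.prod_singleton]
  rw [integral_sub .of_finite .of_finite]
  simp

theorem integral_prod_occ (hN : 2 ≤ N) {ρL ρR : ℝ} {μ : ProbabilityMeasure (Config N)}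
    (hμ : IsStationary (generator hN segmentConductance 1 1 ρL ρR) μ) {n : ℕ}
    {x : Fin n → Site N} (hx : StrictMono x) :
    ∫ η, ∏ i : Fin n, occ η (x i) ∂(μ : Measure (Config N)) =
      ∑ j ∈ Finset.range (n + 1), ρL ^ (n - j) * (ρR - ρL) ^ j *
        ∑ i ∈ increasing j n, tupleWeight x i := by
  have h := expectation_prod_add hN hμ hx fun _ => ρL
  simp only [sub_add_cancel] at h
  rw [← expectation_apply, h]
  refine Finset.sum_congr rfl fun j _ => ?_
  rw [Finset.mul_sum, Finset.mul_sum]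
  refine Finset.sum_congr rfl fun i hi => ?_
  rw [Finset.prod_const, card_compl_image hi]
  ring

theorem integral_prod_occ_sub (hN : 2 ≤ N) {ρL ρR : ℝ} {μ : ProbabilityMeasure (Config N)}
    (hμ : IsStationary (generator hN segmentConductance 1 1 ρL ρR) μ) {n : ℕ}
    {x : Fin n → Site N} (hx : StrictMono x) :
    ∫ η, ∏ i : Fin n, (occ η (x i) - ∫ ζ, occ ζ (x i) ∂(μ : Measure (Config N)))
      ∂(μ : Measure (Config N)) = (ρR - ρL) ^ n * psi x := by
  -- This `b` is `ρL` minus the mean of `η(x_i)`, so the expanded product is the one centred at the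
  -- mean.
  have h := expectation_prod_add hN hμ hx fun i => -(ρR - ρL) * (((x i : ℕ) : ℝ) / N)
  simp only [expectation_occ hN hμ]
  have h2 : (fun η : Config N => ∏ i, (occ η (x i) - (ρL + (ρR - ρL) * (((x i : ℕ) : ℝ) / N)))) =
      fun η => ∏ i, ((occ η (x i) - ρL) + -(ρR - ρL) * (((x i : ℕ) : ℝ) / N)) := by
    funext η
    exact Finset.prod_congr rfl fun i _ => by ring
  rw [h2, ← expectation_apply, h, psi, Finset.mul_sum]
  refine Finset.sum_congr rfl fun j hj => ?_
  have hjn : j ≤ n := Nat.lt_succ_iff.1 (Finset.mem_range.1 hj)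
  rw [Finset.mul_sum, Finset.mul_sum, Finset.mul_sum]
  refine Finset.sum_congr rfl fun i hi => ?_
  -- The `n - j` factors `-(ρR - ρL)` give the sign and, with `(ρR - ρL) ^ j`, the full power `n`.
  rw [Finset.prod_mul_distrib, Finset.prod_const, card_compl_image hi, neg_pow,
    ← pow_mul_pow_sub (ρR - ρL) hjn]
  ring

end OpenSEP

theorem mainTheorem4 (N : ℕ) (hN : 2 ≤ N) (ρL ρR : ℝ)
    (hρL : ρL ∈ Set.Ioo (0 : ℝ) 1) (hρR : ρR ∈ Set.Ioo (0 : ℝ) 1) :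
    ∃ μ : ProbabilityMeasure (OpenSEP.Config N),
      (∀ ν : ProbabilityMeasure (OpenSEP.Config N),
        OpenSEP.IsStationary
          (OpenSEP.generator hN OpenSEP.segmentConductance 1 1 ρL ρR) ν ↔ ν = μ) ∧
      ∀ (n : ℕ) (x : Fin n → OpenSEP.Site N), StrictMono x →
        (∫ η, ∏ i : Fin n, (OpenSEP.occ η (x i)
            - ∫ ζ, OpenSEP.occ ζ (x i) ∂(μ : Measure (OpenSEP.Config N)))
              ∂(μ : Measure (OpenSEP.Config N))
          = (ρR - ρL) ^ n * OpenSEP.psi x) ∧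
        (∫ η, ∏ i : Fin n, OpenSEP.occ η (x i) ∂(μ : Measure (OpenSEP.Config N))
          = ∑ j ∈ Finset.range (n + 1), ρL ^ (n - j) * (ρR - ρL) ^ j *
              ∑ i ∈ OpenSEP.increasing j n, OpenSEP.tupleWeight x i) := by
  obtain ⟨μ, hμ⟩ := OpenSEP.exists_isStationary hN hρL hρR
  refine ⟨μ, fun ν => ⟨fun hν => hμ.unique hN hν, fun h => h ▸ hμ⟩, fun n x hx => ?_⟩
  exact ⟨OpenSEP.integral_prod_occ_sub hN hμ hx, OpenSEP.integral_prod_occ hN hμ hx⟩
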